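/- Let $X$ be a real Banach space with closed unit ball $B_X$. For $C\subseteq X$ let $\mathcal B(C)$ be the family of all nonempty bounded closed convex subsets of $C$. For $\alpha>0$, a map $T$ is called $\alpha$-Hölder nonexpansive if $\|T(x)-T(y)\|\le\|x-y\|^\alpha$ for all $x,y$ in its domain, and nonexpansive if this holds with $\alpha=1$. A set $K\in\mathcal B(X)$ has the FPP (respectively the $\alpha$-HFPP, $0<\alpha<1$) if every nonexpansive (respectively $\alpha$-Hölder nonexpansive) map $T\colon K\to K$ has a fixed point; $X$ has the FPP if every $K\in\mathcal B(X)$ has it. For $T\colon K\to K$ put $\mathrm d(T,K)=\inf_{x\in K}\|x-T(x)\|$. A sequence in $X$ is basic if it is a Schauder basis of its closed linear span, and normalized if all its terms have norm $1$. A sequence $(x_i)$ $1$-dominates $(y_i)$ if $\|\sum_i a_iy_i\|\le\|\sum_i a_ix_i\|$ for all finitely supported real scalars $(a_i)$; a basic sequence is $1$-subspreading if it $1$-dominates each of its subsequences. For a closed convex set $C\subseteq X$ let $\mathcal A_1(C,X)$ be the set of all $\alpha>0$ such that for every nonempty bounded convex (not necessarily closed) $K\subseteq C$, every $\alpha$-Hölder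 nonexpansive $F\colon K\to K$ extends to an $\alpha$-Hölder nonexpansive map $T\colon C\to K$. **Theorem 3.6.** The following statements hold. 1. If $K\in\mathcal B(X)$ has the $\alpha$-HFPP for some $\alpha\in(0,1)$, then $K$ has the FPP. 2. If $X$ is not reflexive, then for every $L>1$, $\lambda\in(1/L,1]$ and $\alpha\in(0,1)$ there exist $K\in\mathcal B(B_X)$ and an affine map $T\colon K\to K$ without fixed points such that $$L^{-1}\|x-y\|\le\|T(x)-T(y)\|\le\lambda\|x-y\|^\alpha\qquad\text{for all }x,y\in K.$$ 3. If $X$ contains a normalized basic sequence which $1$-dominates some subsequence of itself, then for every $\alpha\in(0,1)$ there exist $K\in\mathcal B(B_X)$ and an $\alpha$-Hölder nonexpansive map $T\colon K\to K$ without fixed points such that $\mathrm d(T,K)\le(1/2)^{\frac{2-\alpha}{1-\alpha}}$. 4. If $X$ contains a normalized $1$-subspreading basic sequence and has the FPP, then $1\notin\mathcal A_1(B_X,X)$. -/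

import Mathlib

noncomputable section

namespace HolderFPP

section Maps

/-- `T` is `α`-Hölder nonexpansive: `ρ(T x, T y) ≤ ρ(x, y) ^ α` for all `x, y`. -/
def IsHolderNonexpansive {M N : Type*} [PseudoMetricSpace M] [PseudoMetricSpace N]
    (α : ℝ) (T : M → N) : Prop :=
  ∀ x y : M, dist (T x) (T y) ≤ dist x y ^ α

/-- The fixed point set of a self-map. -/
def fixedPts {M : Type*} (T : M → M) : Set M := {x | x = T x}

end Maps

section Sets

variable {X : Type*} [NormedAddCommGroup X] [NormedSpace ℝ X]

/-- The family of all nonempty bounded closed convex subsets of `C`. -/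
def bccSubsets (C : Set X) : Set (Set X) :=
  {K | K ⊆ C ∧ K.Nonempty ∧ Bornology.IsBounded K ∧ IsClosed K ∧ Convex ℝ K}

/-- `K` has the fixed point property: every nonexpansive (that is, `1`-Lipschitz) self-map of `K`
has a fixed point. -/
def HasFPP (K : Set X) : Prop :=
  ∀ T : K → K, LipschitzWith 1 T → (fixedPts T).Nonempty

/-- `K` has the `α`-Hölder fixed point property: every `α`-Hölder nonexpansive self-map of `K`
has a fixed point. -/
def HasHFPP (α : ℝ) (K : Set X) : Prop :=
  ∀ T : K → K, IsHolderNonexpansive α T → (fixedPts T).Nonempty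

variable (X) in
/-- The space `X` has the fixed point property: all its nonempty bounded closed convex subsets
have it. -/
def SpaceHasFPP : Prop :=
  ∀ K ∈ bccSubsets (Set.univ : Set X), HasFPP K

/-- The minimal displacement `inf {‖x - T x‖ : x ∈ K}` of a self-map of `K`. -/
def minDisplacement {K : Set X} (T : K → K) : ℝ :=
  ⨅ x : K, ‖(x : X) - (T x : X)‖

/-- `T` is affine: it respects those convex combinations that lie in `K` (all of them, when `K`
is convex). -/
def IsAffineSelfMap {K : Set X} (T : K → K) : Prop :=
  ∀ (x y z : K) (a b : ℝ), 0 ≤ a → 0 ≤ b → a + b = 1 →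
    (z : X) = a • (x : X) + b • (y : X) → (T z : X) = a • (T x : X) + b • (T y : X)

/-- The set of all `α > 0` such that for every nonempty bounded convex subset `K` of `C` (closed or
not), each `α`-Hölder nonexpansive map `F : K → K` extends to an `α`-Hölder nonexpansive map
`T : C → K`. -/
def extensionExponents (C : Set X) : Set ℝ :=
  {α | 0 < α ∧ ∀ (K : Set X) (hKC : K ⊆ C), K.Nonempty → Bornology.IsBounded K → Convex ℝ K →
    ∀ F : K → K, IsHolderNonexpansive α F →
      ∃ T : C → K, IsHolderNonexpansive α T ∧ ∀ x : K, T ⟨x, hKC x.2⟩ = F x}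

end Sets

section Sequences

variable {X : Type*} [NormedAddCommGroup X] [NormedSpace ℝ X]

variable (X) in
/-- `X` is reflexive: the canonical map into the bidual is onto. -/
def IsReflexiveSpace : Prop :=
  Function.Surjective (NormedSpace.inclusionInDoubleDual ℝ X)

/-- `x` is a basic sequence: a Schauder basis of its closed linear span. -/
def IsBasicSeq (x : ℕ → X) : Prop :=
  ∃ b : SchauderBasis ℝ (Submodule.span ℝ (Set.range x)).topologicalClosure,
    ∀ n, (b n : X) = x n

/-- `x` is normalized. -/
def IsNormalizedSeq (x : ℕ → X) : Prop := ∀ n, ‖x n‖ = 1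

/-- `x` `1`-dominates `y`: `‖∑ aᵢ yᵢ‖ ≤ ‖∑ aᵢ xᵢ‖` for all finitely supported scalars, that is, the
linear map with `xᵢ ↦ yᵢ` has norm at most `1`. -/
def OneDominates (x y : ℕ → X) : Prop :=
  ∀ a : ℕ →₀ ℝ, ‖a.sum fun i c => c • y i‖ ≤ ‖a.sum fun i c => c • x i‖

/-- `x` is a `1`-subspreading basic sequence: it is basic and `1`-dominates all its
subsequences. -/
def IsOneSubspreading (x : ℕ → X) : Prop :=
  IsBasicSeq x ∧ ∀ n : ℕ → ℕ, StrictMono n → OneDominates x (fun i => x (n i))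

end Sequences

end HolderFPP

end

open HolderFPP

/-! Statements 1 and 3 rest on one fact: every noncompact bounded closed convex set carries, for
each exponent below 1, a fixed-point-free Hölder nonexpansive self-map
(`exists_holder_fixedPointFree`). Noncompactness yields a sequence `y n` far from the subspaces `G
n` containing its earlier terms. Each point is pushed slightly towards at most two consecutive `y
n`, chosen by a partition of unity measuring its distance to the chain. A fixed point would lie on
the segment between them, hence in the union of the chain, hence near an earlier subspace, which
that segment avoids. The resulting map is 2-Lipschitz. Confined to a small ball by a radial
retraction, it becomes Hölder nonexpansive, because a Lipschitz constant is absorbed at small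
scales.

So the Hölder property forces compactness, and compact convex sets have the FPP by approximation
with contractions. For statement 3 the fact is applied to a small ball, where the displacement at
the centre is at most the radius.

For statement 2, nonreflexivity gives James sequences. On the closed convex hull of the vectors, the
identity plus a small operator moving `x k` towards `x (k + 1)` is affine, nearly isometric and
without fixed points.

For statement 4, the shift acts on the non-closed convex hull of the basic sequence and fixes
nothing there. A nonexpansive extension to the ball would have a fixed point, necessarily in that
hull because its values lie there. -/

/-! ### Fixed-point-free maps on noncompact convex sets. -/

section Noncompact

variable {X : Type*} [NormedAddCommGroup X] [NormedSpace ℝ X]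

/-- A closed bounded set which is not compact contains points uniformly far from every
finite-dimensional subspace. -/
theorem exists_forall_finset_span_far [CompleteSpace X] {K : Set X}
    (hb : Bornology.IsBounded K) (hcl : IsClosed K) (hnc : ¬ IsCompact K) :
    ∃ δ : ℝ, 0 < δ ∧ ∀ s : Finset X, ∃ y ∈ K,
      ∀ g ∈ Submodule.span ℝ (s : Set X), δ ≤ ‖y - g‖ := by
  by_contra! H
  refine hnc (isCompact_iff_totallyBounded_isComplete.2 ⟨?_, hcl.isComplete⟩)
  obtain ⟨R, hR⟩ := hb.subset_closedBall 0
  rw [Metric.totallyBounded_iff]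
  intro ε hε
  obtain ⟨s, hs⟩ := H (ε / 2) (by positivity)
  let G := Submodule.span ℝ (s : Set X)
  have : FiniteDimensional ℝ G := FiniteDimensional.span_finset ℝ s
  have hC : IsCompact ((↑) '' (Metric.closedBall (0 : G) (R + ε)) : Set X) :=
    (isCompact_closedBall (0 : G) (R + ε)).image continuous_subtype_val
  obtain ⟨t, ht, hcov⟩ := Metric.totallyBounded_iff.1 hC.totallyBounded (ε / 2) (by positivity)
  refine ⟨t, ht, fun y hy => ?_⟩
  obtain ⟨g, hg, hyg⟩ := hs y hy
  have hgn : ‖g‖ ≤ R + ε := by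
    have h1 : ‖y‖ ≤ R := by simpa using hR hy
    have h2 : ‖g‖ ≤ ‖y‖ + ‖y - g‖ := by
      rw [norm_sub_rev]; simpa using norm_add_le y (g - y)
    linarith
  have := hcov ⟨⟨g, hg⟩, by simpa using hgn, rfl⟩
  simp only [Set.mem_iUnion, Metric.mem_ball, exists_prop] at this ⊢
  obtain ⟨c, hc, hgc⟩ := this
  refine ⟨c, hc, ?_⟩
  have h3 := dist_triangle y g c
  rw [dist_eq_norm y g] at h3
  linarith

/-- In a noncompact closed bounded set there is a sequence each of whose terms is far from
an increasing chain of subspaces containing the earlier terms. -/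
theorem exists_seq_far_chain [CompleteSpace X] {K : Set X}
    (hb : Bornology.IsBounded K) (hcl : IsClosed K) (hnc : ¬ IsCompact K) :
    ∃ δ : ℝ, 0 < δ ∧ ∃ (y : ℕ → X) (G : ℕ → Submodule ℝ X), (∀ n, y n ∈ K) ∧ Monotone G ∧
      (∀ n, y n ∈ G (n + 1)) ∧ ∀ n, ∀ g ∈ G n, δ ≤ ‖y n - g‖ := by
  classical
  obtain ⟨δ, hδ, H⟩ := exists_forall_finset_span_far hb hcl hnc
  choose f hfK hf using H
  obtain ⟨s, hs⟩ : ∃ s : ℕ → Finset X, ∀ n, s (n + 1) = insert (f (s n)) (s n) :=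
    ⟨fun n => Nat.rec ∅ (fun _ t => insert (f t) t) n, fun n => rfl⟩
  refine ⟨δ, hδ, fun n => f (s n), fun n => Submodule.span ℝ (s n : Set X), fun n => hfK _,
    monotone_nat_of_le_succ fun n => Submodule.span_mono ?_, fun n => Submodule.subset_span ?_,
    fun n => hf _⟩
  · rw [hs]; simp
  · rw [hs]; simp

/-- A segment joining two consecutive terms of a far sequence stays away from the subspace
preceding it. -/
theorem le_norm_segment_sub {u v : X} {G H : Submodule ℝ X} (hGH : G ≤ H) (hu : u ∈ H)
    {δ D : ℝ} (hδ : 0 < δ) (hD : 0 < D) (hGu : ∀ g ∈ G, δ ≤ ‖u - g‖)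
    (hHv : ∀ g ∈ H, δ ≤ ‖v - g‖) (huv : ‖u - v‖ ≤ D) {p q : ℝ} (hp : 0 ≤ p) (hq : 0 ≤ q)
    (hpq : p + q = 1) {g : X} (hg : g ∈ G) :
    δ ^ 2 / (δ + D) ≤ ‖p • u + q • v - g‖ := by
  have hsum : 0 < δ + D := by positivity
  -- For large `q`, the distance of `v` from `H` gives `q * δ`; for small `q`, the point is within
  -- `q * D` of `u`. The threshold makes the two bounds equal.
  rcases le_total (δ / (δ + D)) q with h | h
  · have hq0 : 0 < q := lt_of_lt_of_le (by positivity) h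
    have hmem : q⁻¹ • (g - p • u) ∈ H := H.smul_mem _ (H.sub_mem (hGH hg) (H.smul_mem _ hu))
    have e : p • u + q • v - g = q • (v - q⁻¹ • (g - p • u)) := by
      rw [smul_sub, smul_inv_smul₀ hq0.ne']; abel
    rw [e, norm_smul, Real.norm_of_nonneg hq]
    calc δ ^ 2 / (δ + D) = δ / (δ + D) * δ := by ring
      _ ≤ _ := mul_le_mul h (hHv _ hmem) hδ.le hq
  · have e : u - g = (p • u + q • v - g) + q • (u - v) := by
      have : p = 1 - q := by linarith
      subst this; module
    have h1 : ‖u - g‖ ≤ ‖p • u + q • v - g‖ + q * D := by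
      rw [e]
      refine (norm_add_le _ _).trans ?_
      rw [norm_smul, Real.norm_of_nonneg hq]
      gcongr
    have h2 := hGu g hg
    have h3 : q * D ≤ δ / (δ + D) * D := by gcongr
    have h4 : δ ^ 2 / (δ + D) = δ - δ / (δ + D) * D := by field_simp; ring
    linarith

theorem abs_clamp_sub_clamp_le (a b : ℝ) :
    |max 0 (min 1 a) - max 0 (min 1 b)| ≤ |a - b| := by
  have h1 : |max 0 (min 1 a) - max 0 (min 1 b)| ≤ |min 1 a - min 1 b| := by
    simpa [max_comm] using abs_max_sub_max_le_abs (min 1 a) (min 1 b) 0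
  have h2 : |min 1 a - min 1 b| ≤ |a - b| := by
    simpa using abs_min_sub_min_le_max 1 a 1 b
  exact h1.trans h2

/-- A partition of unity subordinate to the distances from an increasing chain of subspaces, at
most two consecutive terms of which are nonzero at a given point. -/
theorem exists_partition_chain {G : ℕ → Submodule ℝ X} (hG : Monotone G) {δ : ℝ} (hδ : 0 < δ) :
    ∃ (A : ℝ) (a : ℕ → X → ℝ), 0 ≤ A ∧ (∀ n x, 0 ≤ a n x) ∧ (∀ n x, a n x ≤ 1) ∧
      (∀ n x y, |a n x - a n y| ≤ A * 2 ^ n * ‖x - y‖) ∧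
      ∀ x, ∃ m, (∀ n, n ≠ m → n ≠ m + 1 → a n x = 0) ∧ a m x + a (m + 1) x = 1 ∧
        ∀ k, x ∈ G k → ∃ g ∈ G (m + 1), ‖x - g‖ < δ := by
  let U : Set X := ⋃ n, (G n : Set X)
  have hne : ∀ n, (G n : Set X).Nonempty := fun n => ⟨0, (G n).zero_mem⟩
  have hGU : ∀ n, (G n : Set X) ⊆ U := fun n => Set.subset_iUnion (fun n => (G n : Set X)) n
  have hUne : U.Nonempty := (hne 0).mono (hGU 0)
  -- On `U` this is the distance to `G n`. Off the closure of `U` that distance stays bounded below,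
  -- and the subtracted term still makes `d n x` eventually small.
  let d : ℕ → X → ℝ := fun n x => Metric.infDist x (G n) - 2 * Metric.infDist x U
  have hd_anti : ∀ n x, d (n + 1) x ≤ d n x := fun n x => by
    have : Metric.infDist x (G (n + 1)) ≤ Metric.infDist x (G n) :=
      Metric.infDist_le_infDist_of_subset (hG n.le_succ) (hne n)
    simp only [d]; linarith
  have hinf : ∀ (s : Set X) x y, |Metric.infDist x s - Metric.infDist y s| ≤ ‖x - y‖ := by
    intro s x y
    have h1 := Metric.infDist_le_infDist_add_dist (s := s) (x := x) (y := y)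
    have h2 := Metric.infDist_le_infDist_add_dist (s := s) (x := y) (y := x)
    rw [dist_comm] at h2
    rw [← dist_eq_norm, abs_le]
    constructor <;> linarith
  have hd_lip : ∀ n x y, |d n x - d n y| ≤ 3 * ‖x - y‖ := fun n x y => by
    have h1 := abs_le.1 (hinf (G n) x y)
    have h2 := abs_le.1 (hinf U x y)
    simp only [d]
    rw [abs_le]
    constructor <;> linarith
  have hd_small : ∀ x, ∀ η > 0, ∃ n, d n x < η := by
    intro x η hη
    obtain ⟨g, hg, hxg⟩ := (Metric.infDist_lt_iff hUne).1
      (lt_add_of_pos_right (Metric.infDist x U) hη)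
    obtain ⟨n, hn⟩ := Set.mem_iUnion.1 hg
    refine ⟨n, ?_⟩
    have h1 := Metric.infDist_le_dist_of_mem (x := x) hn
    have h2 := Metric.infDist_nonneg (x := x) (s := U)
    simp only [d]; linarith
  -- The thresholds increase from `δ / 2` towards `δ`, and `h n` ramps from 0 to 1 between `τ n` and
  -- `τ (n + 1)`. As `d` decreases in `n`, `h n x < 1` forces `h (n + 1) x = 0`.
  let τ : ℕ → ℝ := fun n => δ * (1 - (1 / 2) ^ (n + 1))
  have hτ : ∀ n, (τ (n + 1) - τ n) * (2 ^ (n + 2) / δ) = 1 := fun n => by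
    simp only [τ, one_div, inv_pow]; field_simp; ring
  have hτ0 : τ 0 = δ / 2 := by simp only [τ]; ring
  have hτδ : ∀ n, τ n < δ := fun n => by
    have : (0 : ℝ) < (1 / 2) ^ (n + 1) := by positivity
    simp only [τ]; nlinarith
  let h : ℕ → X → ℝ := fun n x => max 0 (min 1 ((d n x - τ n) * (2 ^ (n + 2) / δ)))
  have hκ : ∀ n : ℕ, (0 : ℝ) < 2 ^ (n + 2) / δ := fun n => by positivity
  have h0 : ∀ n x, 0 ≤ h n x := fun n x => le_max_left _ _
  have h1 : ∀ n x, h n x ≤ 1 := fun n x => max_le zero_le_one (min_le_left _ _)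
  have hzero : ∀ n x, d n x ≤ τ n → h n x = 0 := fun n x hx => by
    refine max_eq_left ((min_le_right _ _).trans ?_)
    exact mul_nonpos_of_nonpos_of_nonneg (by linarith) (hκ n).le
  have hle_of_zero : ∀ n x, h n x = 0 → d n x ≤ τ n := fun n x hx => by
    by_contra! hlt
    have : 0 < h n x :=
      lt_max_of_lt_right (lt_min one_pos (mul_pos (by linarith) (hκ n)))
    linarith
  have hone : ∀ n x, τ (n + 1) ≤ d n x → h n x = 1 := fun n x hx => by
    have h3 : 1 ≤ (d n x - τ n) * (2 ^ (n + 2) / δ) := by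
      rw [← hτ n]; exact mul_le_mul_of_nonneg_right (by linarith) (hκ n).le
    simp only [h]
    rw [min_eq_left h3, max_eq_right zero_le_one]
  have hstep : ∀ n x, h n x < 1 → h (n + 1) x = 0 := fun n x hx => by
    refine hzero _ _ ?_
    by_contra! hlt
    exact hx.ne (hone n x (hlt.le.trans (hd_anti n x)))
  have hmono : ∀ n x, h (n + 1) x ≤ h n x := fun n x => by
    rcases lt_or_ge (h n x) 1 with hx | hx
    · rw [hstep n x hx]; exact h0 n x
    · exact (h1 _ _).trans hx
  have hlip : ∀ n x y, |h n x - h n y| ≤ 12 / δ * 2 ^ n * ‖x - y‖ := fun n x y => by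
    refine (abs_clamp_sub_clamp_le _ _).trans ?_
    rw [← sub_mul, abs_mul, abs_of_pos (hκ n)]
    have := mul_le_mul_of_nonneg_right (hd_lip n x y) (hκ n).le
    calc _ = |d n x - d n y| * (2 ^ (n + 2) / δ) := by congr 2; ring
      _ ≤ _ := this
      _ = _ := by ring
  -- The values `h n x` read 1, …, 1, `h m x`, 0, 0, …, so their successive drops vanish except at
  -- `m` and `m + 1`.
  let a : ℕ → X → ℝ := fun n x => Nat.casesOn n (1 - h 0 x) (fun k => h k x - h (k + 1) x)
  have ha0 : ∀ x, a 0 x = 1 - h 0 x := fun x => rfl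
  have haS : ∀ n x, a (n + 1) x = h n x - h (n + 1) x := fun n x => rfl
  refine ⟨24 / δ, a, by positivity, ?_, ?_, ?_, ?_⟩
  · rintro (_ | n) x
    · rw [ha0]; linarith [h1 0 x]
    · rw [haS]; linarith [hmono n x]
  · rintro (_ | n) x
    · rw [ha0]; linarith [h0 0 x]
    · rw [haS]; linarith [h0 (n + 1) x, h1 n x]
  · rintro (_ | n) x y
    · have := hlip 0 x y
      have h5 : 0 ≤ 12 / δ * ‖x - y‖ := by positivity
      rw [ha0, ha0, show 1 - h 0 x - (1 - h 0 y) = -(h 0 x - h 0 y) by ring, abs_neg]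
      refine this.trans ?_
      have : 24 / δ * 2 ^ 0 * ‖x - y‖ = 12 / δ * 2 ^ 0 * ‖x - y‖ + 12 / δ * ‖x - y‖ := by ring
      linarith
    · have h3 := abs_le.1 (hlip n x y)
      have h4 := abs_le.1 (hlip (n + 1) x y)
      have h5 : 0 ≤ 12 / δ * 2 ^ n * ‖x - y‖ := by positivity
      rw [haS, haS, abs_le]
      rw [pow_succ] at h4 ⊢
      have e : 24 / δ * (2 ^ n * 2) * ‖x - y‖ = 4 * (12 / δ * 2 ^ n * ‖x - y‖) := by ring
      have e' : 12 / δ * (2 ^ n * 2) * ‖x - y‖ = 2 * (12 / δ * 2 ^ n * ‖x - y‖) := by ring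
      rw [e'] at h4
      rw [e]
      constructor <;> linarith [h3.1, h3.2, h4.1, h4.2]
  · intro x
    have hex : ∃ m, h m x < 1 := by
      obtain ⟨n, hn⟩ := hd_small x (δ / 2) (by positivity)
      refine ⟨n, ?_⟩
      have : τ 0 ≤ τ n := by
        have : ((1 : ℝ) / 2) ^ (n + 1) ≤ (1 / 2) ^ (0 + 1) :=
          pow_le_pow_of_le_one (by norm_num) (by norm_num) (by omega)
        simp only [τ]; nlinarith
      rw [hzero n x (by linarith)]; exact one_pos
    classical
    let m := Nat.find hex
    have hm : h m x < 1 := Nat.find_spec hex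
    have hlt : ∀ k < m, h k x = 1 := fun k hk =>
      le_antisymm (h1 k x) (not_lt.1 (Nat.find_min hex hk))
    have hgt : ∀ k, m < k → h k x = 0 := by
      intro k hk
      induction k, hk using Nat.le_induction with
      | base => exact hstep m x hm
      | succ k hk ih => exact le_antisymm ((hmono k x).trans ih.le) (h0 _ _)
    have ham : a m x = 1 - h m x := by
      rcases hm' : m with _ | k
      · rw [ha0]
      · rw [haS, hlt k (by omega)]
    refine ⟨m, ?_, ?_, ?_⟩
    · rintro (_ | n) hn hn'
      · rw [ha0, hlt 0 (by omega), sub_self]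
      · rw [haS]
        rcases lt_or_ge (n + 1) m with hc | hc
        · rw [hlt n (by omega), hlt (n + 1) hc, sub_self]
        · rw [hgt n (by omega), hgt (n + 1) (by omega), sub_self]
    · rw [ham, haS, hgt (m + 1) (by omega)]; ring
    · intro k hk
      have hU : Metric.infDist x U = 0 := Metric.infDist_zero_of_mem (hGU k hk)
      have h4 := hle_of_zero _ _ (hgt (m + 1) (by omega))
      simp only [d, hU] at h4
      obtain ⟨g, hg, hxg⟩ := (Metric.infDist_lt_iff (hne (m + 1))).1
        (show Metric.infDist x (G (m + 1)) < δ by linarith [hτδ (m + 1)])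
      exact ⟨g, hg, by rwa [← dist_eq_norm]⟩

/-- A noncompact bounded closed convex set admits a `2`-Lipschitz self-map without fixed points. -/
theorem exists_lipschitz_two_fixedPointFree [CompleteSpace X] {K : Set X}
    (hb : Bornology.IsBounded K) (hcl : IsClosed K) (hcv : Convex ℝ K) (hnc : ¬ IsCompact K) :
    ∃ T : X → X, (∀ x ∈ K, T x ∈ K) ∧ (∀ x ∈ K, ∀ y ∈ K, ‖T x - T y‖ ≤ 2 * ‖x - y‖) ∧
      ∀ x ∈ K, T x ≠ x := by
  obtain ⟨δ, hδ, y, G, hyK, hG, hyG, hfar⟩ := exists_seq_far_chain hb hcl hnc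
  obtain ⟨D, hD0, hD⟩ : ∃ D : ℝ, 0 < D ∧ ∀ u ∈ K, ∀ v ∈ K, ‖u - v‖ ≤ D := by
    obtain ⟨D, hD⟩ := Metric.isBounded_iff.1 hb
    exact ⟨max D 1, by positivity, fun u hu v hv => by
      rw [← dist_eq_norm]; exact (hD hu hv).trans (le_max_left _ _)⟩
  obtain ⟨A, a, hA, ha0, ha1, halip, hapart⟩ :=
    exists_partition_chain hG (δ := δ ^ 2 / (δ + D)) (by positivity)
  -- The factor `(1 / 4) ^ n` beats the growth `2 ^ n` of the Lipschitz constants of `a n`; the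
  -- perturbation then has total Lipschitz constant at most 1.
  let c : ℕ → ℝ := fun n => 1 / (2 * (A * D + 1)) * (1 / 4) ^ n
  have hcpos : ∀ n, 0 < c n := fun n => by positivity
  have hc2 : ∀ n, c n ≤ 1 / 2 := fun n => by
    have e1 : ((1 : ℝ) / 4) ^ n ≤ 1 := pow_le_one₀ (by norm_num) (by norm_num)
    have e2 : 1 / (2 * (A * D + 1)) ≤ 1 / 2 := by
      apply one_div_le_one_div_of_le two_pos
      nlinarith [mul_nonneg hA hD0.le]
    calc c n ≤ 1 / 2 * 1 := mul_le_mul e2 e1 (by positivity) (by norm_num)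
      _ = _ := by ring
  let t : X → ℕ → X := fun x n => (c n * a n x) • (y (n + 1) - x)
  let T : X → X := fun x => x + ∑' n, t x n
  have hfin : ∀ x m, (∀ n, n ≠ m → n ≠ m + 1 → a n x = 0) → ∀ n ∉ ({m, m + 1} : Finset ℕ),
      t x n = 0 := by
    intro x m hm n hn
    simp only [Finset.mem_insert, Finset.mem_singleton, not_or] at hn
    simp [t, hm n hn.1 hn.2]
  have hT : ∀ x m, (∀ n, n ≠ m → n ≠ m + 1 → a n x = 0) →
      T x = x + (t x m + t x (m + 1)) := by
    intro x m hm
    simp only [T]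
    rw [tsum_eq_sum (hfin x m hm), Finset.sum_pair (by omega)]
  have hsum : ∀ x, Summable (t x) := fun x => by
    obtain ⟨m, hm, -⟩ := hapart x
    exact summable_of_ne_finset_zero (hfin x m hm)
  refine ⟨T, ?_, ?_, ?_⟩
  · intro x hx
    obtain ⟨m, hm, hm1, -⟩ := hapart x
    rw [hT x m hm]
    have hp : ∀ n, 0 ≤ c n * a n x := fun n => mul_nonneg (hcpos n).le (ha0 n x)
    have hp' : ∀ n, c n * a n x ≤ 1 / 2 := fun n => by
      nlinarith [hc2 n, ha1 n x, ha0 n x, hcpos n]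
    -- Halving turns the two pushes into a midpoint of two points of segments in `K`; this is where
    -- `c n ≤ 1 / 2` is needed.
    have e : x + (t x m + t x (m + 1)) = (1 / 2 : ℝ) • (x + (2 * (c m * a m x)) • (y (m + 1) - x))
        + (1 / 2 : ℝ) • (x + (2 * (c (m + 1) * a (m + 1) x)) • (y (m + 2) - x)) := by
      simp only [t]; module
    rw [e]
    exact hcv (hcv.add_smul_sub_mem hx (hyK _) ⟨by linarith [hp m], by linarith [hp' m]⟩)
      (hcv.add_smul_sub_mem hx (hyK _) ⟨by linarith [hp (m + 1)], by linarith [hp' (m + 1)]⟩)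
      (by norm_num) (by norm_num) (by norm_num)
  · intro x hx z hz
    have hterm : ∀ n, ‖t x n - t z n‖ ≤ 1 / 2 * ‖x - z‖ * (1 / 2) ^ n := by
      intro n
      have e : t x n - t z n = c n • ((a n x - a n z) • (y (n + 1) - x) - a n z • (x - z)) := by
        simp only [t]; module
      have e1 : ‖(a n x - a n z) • (y (n + 1) - x) - a n z • (x - z)‖
          ≤ (A * 2 ^ n * ‖x - z‖) * D + 1 * ‖x - z‖ := by
        refine (norm_sub_le _ _).trans (add_le_add ?_ ?_)
        · rw [norm_smul, Real.norm_eq_abs]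
          exact mul_le_mul (halip n x z) (hD _ (hyK _) _ hx) (norm_nonneg _) (by positivity)
        · rw [norm_smul, Real.norm_of_nonneg (ha0 n z)]
          exact mul_le_mul_of_nonneg_right (ha1 n z) (norm_nonneg _)
      have e2 : (A * 2 ^ n * ‖x - z‖) * D + 1 * ‖x - z‖ ≤ (A * D + 1) * 2 ^ n * ‖x - z‖ := by
        have : (1 : ℝ) ≤ 2 ^ n := one_le_pow₀ (by norm_num)
        nlinarith [norm_nonneg (x - z), mul_le_mul_of_nonneg_right this (norm_nonneg (x - z))]
      rw [e, norm_smul, Real.norm_of_nonneg (hcpos n).le]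
      calc c n * _ ≤ c n * ((A * D + 1) * 2 ^ n * ‖x - z‖) :=
            mul_le_mul_of_nonneg_left (e1.trans e2) (hcpos n).le
        _ = 1 / 2 * ‖x - z‖ * (1 / 2) ^ n := by
            have h4 : ((1 : ℝ) / 4) ^ n = (1 / 2) ^ n * (1 / 2) ^ n := by
              rw [← mul_pow]; norm_num
            have h5 : ((1 : ℝ) / 2) ^ n * 2 ^ n = 1 := by rw [← mul_pow]; norm_num
            have h6 : A * D + 1 ≠ 0 := by positivity
            simp only [c]
            rw [h4]
            calc _ = (A * D + 1) / (A * D + 1) * (1 / 2 * ‖x - z‖ * (1 / 2) ^ n)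
                  * ((1 / 2) ^ n * 2 ^ n) := by field_simp
              _ = _ := by rw [h5, div_self h6]; ring
    have hg : HasSum (fun n : ℕ => 1 / 2 * ‖x - z‖ * (1 / 2 : ℝ) ^ n) (1 / 2 * ‖x - z‖ * 2) :=
      hasSum_geometric_two.mul_left _
    have e : T x - T z = (x - z) + ∑' n, (t x n - t z n) := by
      rw [(hsum x).tsum_sub (hsum z)]; simp only [T]; abel
    rw [e]
    calc _ ≤ ‖x - z‖ + 1 / 2 * ‖x - z‖ * 2 :=
          (norm_add_le _ _).trans (by gcongr; exact tsum_of_norm_bounded hg hterm)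
      _ = _ := by ring
  · intro x hx hfix
    obtain ⟨m, hm, hm1, hnear⟩ := hapart x
    rw [hT x m hm] at hfix
    have hz : t x m + t x (m + 1) = 0 := by simpa using hfix
    let p := c m * a m x
    let q := c (m + 1) * a (m + 1) x
    have hp : 0 ≤ p := mul_nonneg (hcpos _).le (ha0 _ _)
    have hq : 0 ≤ q := mul_nonneg (hcpos _).le (ha0 _ _)
    have hpq : 0 < p + q := by
      rcases (ha0 m x).lt_or_eq with h | h
      · have : 0 < p := mul_pos (hcpos _) h
        linarith
      · have : 0 < q := mul_pos (hcpos _) (by linarith)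
        linarith
    have hx' : x = (p / (p + q)) • y (m + 1) + (q / (p + q)) • y (m + 2) := by
      have e : (p + q) • x = p • y (m + 1) + q • y (m + 2) := by
        have : p • (y (m + 1) - x) + q • (y (m + 2) - x) = 0 := hz
        rw [← sub_eq_zero, ← neg_eq_zero, ← this]; module
      calc x = (p + q)⁻¹ • (p + q) • x := (inv_smul_smul₀ hpq.ne' x).symm
        _ = _ := by rw [e]; module
    -- Membership in the chain activates the closeness of `x` to `G (m + 1)`, contradicting the
    -- segment estimate.
    have hxG : x ∈ G (m + 3) := by
      rw [hx']
      exact (G _).add_mem ((G _).smul_mem _ (hG (by omega) (hyG (m + 1))))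
        ((G _).smul_mem _ (hyG (m + 2)))
    obtain ⟨g, hg, hlt⟩ := hnear _ hxG
    have hle := le_norm_segment_sub (hG (Nat.le_succ (m + 1))) (hyG (m + 1)) hδ hD0
      (hfar (m + 1)) (hfar (m + 2)) (hD _ (hyK _) _ (hyK _)) (div_nonneg hp hpq.le)
      (div_nonneg hq hpq.le) (by field_simp) hg
    rw [← hx'] at hle
    linarith

/-! ### From Lipschitz to Hölder maps by shrinking the scale. -/

/-- The radial retraction onto a ball is `2`-Lipschitz. -/
theorem norm_radial_sub_le {r : ℝ} (hr : 0 < r) (v w : X) :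
    ‖(r / max r ‖v‖) • v - (r / max r ‖w‖) • w‖ ≤ 2 * ‖v - w‖ := by
  have hM : 0 < max r ‖v‖ := lt_max_of_lt_left hr
  have hN : 0 < max r ‖w‖ := lt_max_of_lt_left hr
  have e : (r / max r ‖v‖) • v - (r / max r ‖w‖) • w = (r / max r ‖v‖) • (v - w)
      + (r / max r ‖v‖ * ((max r ‖w‖ - max r ‖v‖) / max r ‖w‖)) • w := by
    have : r / max r ‖w‖ =
        r / max r ‖v‖ - r / max r ‖v‖ * ((max r ‖w‖ - max r ‖v‖) / max r ‖w‖) := by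
      field_simp; ring
    rw [this]; module
  have h1 : r / max r ‖v‖ ≤ 1 := (div_le_one hM).2 (le_max_left _ _)
  have h2 : ‖w‖ / max r ‖w‖ ≤ 1 := (div_le_one hN).2 (le_max_right _ _)
  have h3 : |max r ‖w‖ - max r ‖v‖| ≤ ‖v - w‖ := by
    rw [abs_sub_comm]
    have : |max r ‖v‖ - max r ‖w‖| ≤ |‖v‖ - ‖w‖| := by
      simpa using abs_max_sub_max_le_max r ‖v‖ r ‖w‖
    exact this.trans (abs_norm_sub_norm_le v w)
  rw [e, two_mul]
  refine (norm_add_le _ _).trans (add_le_add ?_ ?_)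
  · rw [norm_smul, Real.norm_of_nonneg (by positivity)]
    exact mul_le_of_le_one_left (norm_nonneg _) h1
  · rw [norm_smul, Real.norm_eq_abs, abs_mul, abs_of_nonneg (by positivity : 0 ≤ r / max r ‖v‖),
      abs_div, abs_of_pos hN]
    calc r / max r ‖v‖ * (|max r ‖w‖ - max r ‖v‖| / max r ‖w‖) * ‖w‖
        = r / max r ‖v‖ * (|max r ‖w‖ - max r ‖v‖| * (‖w‖ / max r ‖w‖)) := by ring
      _ ≤ 1 * (‖v - w‖ * 1) := by gcongr
      _ = _ := by ring

/-- Since `1 - α > 0`, a small enough scale absorbs any Lipschitz constant `M`; `2 * δ` is the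
diameter bound for a ball of radius `δ`. -/
theorem exists_scale_rpow_le {M lam α : ℝ} (hM : 0 < M) (hlam : 0 < lam) (hα : α < 1) :
    ∃ δ : ℝ, 0 < δ ∧ δ ≤ 1 ∧ M * (2 * δ) ^ (1 - α) ≤ lam := by
  have h1 : 0 < 1 - α := by linarith
  refine ⟨min 1 ((lam / M) ^ (1 / (1 - α)) / 2), by positivity, min_le_left _ _, ?_⟩
  have h2 : 2 * min 1 ((lam / M) ^ (1 / (1 - α)) / 2) ≤ (lam / M) ^ (1 / (1 - α)) := by
    linarith [min_le_right 1 ((lam / M) ^ (1 / (1 - α)) / 2)]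
  calc M * (2 * min 1 ((lam / M) ^ (1 / (1 - α)) / 2)) ^ (1 - α)
      ≤ M * ((lam / M) ^ (1 / (1 - α))) ^ (1 - α) := by gcongr
    _ = lam := by
        rw [← Real.rpow_mul (by positivity), one_div_mul_cancel h1.ne', Real.rpow_one]
        field_simp

theorem le_rpow_mul_rpow {r D α : ℝ} (h0 : 0 ≤ r) (hr : r ≤ D) (h1 : α < 1) :
    r ≤ D ^ (1 - α) * r ^ α := by
  rcases h0.eq_or_lt with rfl | hpos
  · positivity
  · calc r = r ^ (1 - α) * r ^ α := by rw [← Real.rpow_add hpos]; simp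
      _ ≤ D ^ (1 - α) * r ^ α := by
        gcongr

/-- For every `0 < α < 1`, a noncompact bounded closed convex set admits an `α`-Hölder nonexpansive
self-map without fixed points. -/
theorem exists_holder_fixedPointFree [CompleteSpace X] {K : Set X}
    (hb : Bornology.IsBounded K) (hcl : IsClosed K) (hcv : Convex ℝ K) (hnc : ¬ IsCompact K)
    {α : ℝ} (h0 : 0 < α) (h1 : α < 1) :
    ∃ T : K → K, IsHolderNonexpansive α T ∧ fixedPts T = ∅ := by
  obtain ⟨x₀, hx₀⟩ : K.Nonempty := by
    by_contra h
    rw [Set.not_nonempty_iff_eq_empty] at h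
    exact hnc (h ▸ isCompact_empty)
  obtain ⟨r, hr, hr1, hrα⟩ := exists_scale_rpow_le (M := 4) (lam := 1) (by norm_num) one_pos h1
  let B := K ∩ Metric.closedBall x₀ r
  have hBnc : ¬ IsCompact B := by
    -- A homothety centred at `x₀` shrinks `K` into `B`, so compactness of `B` would pass to `K`.
    intro hB
    obtain ⟨D, hD⟩ := hb.subset_closedBall x₀
    let ε := r / (r + |D|)
    have hden : 0 < r + |D| := by positivity
    have hε : 0 < ε := by positivity
    have hε1 : ε ≤ 1 := (div_le_one hden).2 (by linarith [abs_nonneg D])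
    have hf : Continuous fun z : X => x₀ + ε⁻¹ • (z - x₀) := by fun_prop
    refine hnc ((hB.image hf).of_isClosed_subset hcl fun x hx => ?_)
    refine ⟨x₀ + ε • (x - x₀), ⟨hcv.add_smul_sub_mem hx₀ hx ⟨hε.le, hε1⟩, ?_⟩, ?_⟩
    · have h2 : ‖x - x₀‖ ≤ D := by simpa [dist_eq_norm] using hD hx
      rw [mem_closedBall_iff_norm, add_sub_cancel_left, norm_smul, Real.norm_of_nonneg hε.le]
      calc ε * ‖x - x₀‖ ≤ ε * (r + |D|) := by gcongr; linarith [le_abs_self D]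
        _ = r := div_mul_cancel₀ _ hden.ne'
    · simp [smul_smul, inv_mul_cancel₀ hε.ne']
  obtain ⟨U, hUB, hUlip, hUfix⟩ := exists_lipschitz_two_fixedPointFree
    (hb.subset Set.inter_subset_left) (hcl.inter Metric.isClosed_closedBall)
    (hcv.inter (convex_closedBall x₀ r)) hBnc
  let ρ : X → X := fun x => x₀ + (r / max r ‖x - x₀‖) • (x - x₀)
  have hρB : ∀ x ∈ K, ρ x ∈ B := by
    intro x hx
    have hM : 0 < max r ‖x - x₀‖ := lt_max_of_lt_left hr
    refine ⟨hcv.add_smul_sub_mem hx₀ hx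
      ⟨by positivity, (div_le_one hM).2 (le_max_left _ _)⟩, ?_⟩
    simp only [ρ]
    rw [mem_closedBall_iff_norm, add_sub_cancel_left, norm_smul,
      Real.norm_of_nonneg (by positivity), div_mul_eq_mul_div, div_le_iff₀ hM]
    gcongr
    exact le_max_right _ _
  have hρid : ∀ x ∈ B, ρ x = x := by
    rintro x ⟨-, hx⟩
    rw [mem_closedBall_iff_norm] at hx
    simp [ρ, max_eq_left hx, div_self hr.ne']
  refine ⟨fun x => ⟨U (ρ x), (hUB _ (hρB _ x.2)).1⟩, ?_, ?_⟩
  · intro x y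
    have hU : ∀ z : K, U (ρ z) ∈ Metric.closedBall x₀ r := fun z => (hUB _ (hρB _ z.2)).2
    rw [Subtype.dist_eq, Subtype.dist_eq]
    have hsm : dist (U (ρ x)) (U (ρ y)) ≤ 2 * r := by
      have := dist_triangle_right (U (ρ x)) (U (ρ y)) x₀
      have h2 := Metric.mem_closedBall.1 (hU x)
      have h3 := Metric.mem_closedBall.1 (hU y)
      linarith
    have hlip : dist (U (ρ x)) (U (ρ y)) ≤ 4 * dist (x : X) y := by
      rw [dist_eq_norm, dist_eq_norm]
      have h2 := hUlip _ (hρB _ x.2) _ (hρB _ y.2)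
      have h3 := norm_radial_sub_le hr ((x : X) - x₀) ((y : X) - x₀)
      have e : ρ x - ρ y = (r / max r ‖(x : X) - x₀‖) • ((x : X) - x₀)
          - (r / max r ‖(y : X) - x₀‖) • ((y : X) - x₀) := by simp only [ρ]; abel
      rw [← e, sub_sub_sub_cancel_right] at h3
      linarith
    calc dist (U (ρ x)) (U (ρ y))
        ≤ (2 * r) ^ (1 - α) * dist (U (ρ x)) (U (ρ y)) ^ α := le_rpow_mul_rpow dist_nonneg hsm h1
      _ ≤ (2 * r) ^ (1 - α) * (4 * dist (x : X) y) ^ α := by gcongr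
      _ = (2 * r) ^ (1 - α) * (4 ^ α * dist (x : X) y ^ α) := by
          rw [Real.mul_rpow (by norm_num) dist_nonneg]
      _ ≤ (2 * r) ^ (1 - α) * (4 * dist (x : X) y ^ α) := by
          gcongr
          calc (4 : ℝ) ^ α ≤ 4 ^ (1 : ℝ) := Real.rpow_le_rpow_of_exponent_le (by norm_num) h1.le
            _ = 4 := Real.rpow_one 4
      _ = (4 * (2 * r) ^ (1 - α)) * dist (x : X) y ^ α := by ring
      _ ≤ 1 * dist (x : X) y ^ α := by gcongr
      _ = _ := one_mul _
  · rw [Set.eq_empty_iff_forall_notMem]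
    intro x hx
    have hx' : (x : X) = U (ρ x) := congrArg Subtype.val hx
    have hxB : (x : X) ∈ B := hx' ▸ hUB _ (hρB _ x.2)
    rw [hρid _ hxB] at hx'
    exact hUfix _ hxB hx'.symm

end Noncompact

/-! ### Affine maps in nonreflexive spaces. -/

section Nonreflexive

/-- **Helly's lemma**: on finitely many functionals, an element of the bidual is represented by a
vector of almost the same norm. -/
theorem exists_forall_apply_eq_of_bidual {E : Type*} [NormedAddCommGroup E] [NormedSpace ℝ E]
    (Φ : StrongDual ℝ (StrongDual ℝ E)) (s : Finset (StrongDual ℝ E)) :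
    ∃ x : E, ‖x‖ ≤ ‖Φ‖ + 1 ∧ ∀ f ∈ s, f x = Φ f := by
  let π : E →L[ℝ] (s → ℝ) := ContinuousLinearMap.pi fun f => f.1
  let N : Submodule ℝ E := LinearMap.ker (π : E →ₗ[ℝ] (s → ℝ))
  have hN : IsClosed (N : Set E) := π.isClosed_ker
  have : FiniteDimensional ℝ (E ⧸ N) :=
    (LinearMap.quotKerEquivRange (π : E →ₗ[ℝ] (s → ℝ))).symm.finiteDimensional
  -- `Φ` restricted to functionals factoring through the finite-dimensional quotient is evaluation
  -- at a point `q` there.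
  let ψ : Module.Dual ℝ (Module.Dual ℝ (E ⧸ N)) :=
    { toFun := fun g => Φ ((LinearMap.toContinuousLinearMap g).comp N.mkQL)
      map_add' := fun g g' => by simp [ContinuousLinearMap.add_comp]
      map_smul' := fun c g => by simp [ContinuousLinearMap.smul_comp] }
  let q := (Module.evalEquiv ℝ (E ⧸ N)).symm ψ
  have hq : ∀ g : StrongDual ℝ (E ⧸ N), g q = Φ (g.comp N.mkQL) := fun g =>
    Module.apply_evalEquiv_symm_apply ℝ (E ⧸ N) (g : Module.Dual ℝ (E ⧸ N)) ψ
  have hqn : ‖q‖ ≤ ‖Φ‖ := by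
    obtain ⟨g, hg, hgq⟩ := exists_dual_vector'' ℝ q
    have h1 : ‖g.comp N.mkQL‖ ≤ 1 := by
      refine ContinuousLinearMap.opNorm_le_bound _ zero_le_one fun x => ?_
      refine (g.le_opNorm _).trans ?_
      gcongr
      exact Submodule.Quotient.norm_mk_le N x
    have h2 : g q = ‖q‖ := by simpa using hgq
    rw [← h2, hq]
    refine (le_abs_self _).trans ((Φ.le_opNorm _).trans ?_)
    exact mul_le_of_le_one_right (norm_nonneg _) h1
  obtain ⟨x, hx, hxn⟩ := Submodule.Quotient.norm_mk_lt q one_pos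
  refine ⟨x, by linarith, fun f hf => ?_⟩
  have hker : N ≤ LinearMap.ker (f : E →ₗ[ℝ] ℝ) := fun z hz => congrFun hz ⟨f, hf⟩
  have h := hq (N.liftQL f hker)
  rw [← hx] at h
  have e : (N.liftQL f hker).comp N.mkQL = f := by ext z; rfl
  rw [e] at h
  exact h

theorem exists_dual_eq_one_of_notMem {E : Type*} [NormedAddCommGroup E] [NormedSpace ℝ E]
    {R : Submodule ℝ E} (hR : IsClosed (R : Set E)) {z : E} (hz : z ∉ R) :
    ∃ u : StrongDual ℝ E, u z = 1 ∧ ∀ w ∈ R, u w = 0 := by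
  have hmk : R.mkQL z ≠ 0 := fun h => hz ((Submodule.Quotient.mk_eq_zero R).1 h)
  obtain ⟨u, hu⟩ := SeparatingDual.exists_eq_one (R := ℝ) hmk
  refine ⟨u.comp R.mkQL, hu, fun w hw => ?_⟩
  have : R.mkQL w = 0 := (Submodule.Quotient.mk_eq_zero R).2 hw
  rw [ContinuousLinearMap.comp_apply, this, map_zero]

/-- Completeness makes the isometric image of `X` closed in the bidual, so Hahn–Banach separates `Φ`
from it. -/
theorem exists_annihilator_range_inclusion {X : Type*} [NormedAddCommGroup X] [NormedSpace ℝ X]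
    [CompleteSpace X] {Φ : StrongDual ℝ (StrongDual ℝ X)}
    (hΦ : ∀ x, NormedSpace.inclusionInDoubleDual ℝ X x ≠ Φ) :
    ∃ Ψ : StrongDual ℝ (StrongDual ℝ (StrongDual ℝ X)), Ψ Φ = 1 ∧
      ∀ x, Ψ (NormedSpace.inclusionInDoubleDual ℝ X x) = 0 := by
  let J := NormedSpace.inclusionInDoubleDualLi (E := X) ℝ
  have hR : IsClosed (LinearMap.range J.toLinearMap : Set (StrongDual ℝ (StrongDual ℝ X))) :=
    J.isometry.isUniformInducing.isComplete_range.isClosed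
  obtain ⟨Ψ, h1, h0⟩ := exists_dual_eq_one_of_notMem hR (z := Φ) (by
    rintro ⟨x, hx⟩
    exact hΦ x hx)
  exact ⟨Ψ, h1, fun x => h0 _ ⟨x, rfl⟩⟩

theorem exists_bound_forall_apply_eq_of_bidual {E : Type*} [NormedAddCommGroup E] [NormedSpace ℝ E]
    (Φ : StrongDual ℝ (StrongDual ℝ E)) :
    ∃ B : ℝ, 0 < B ∧ ∀ s : Finset (StrongDual ℝ E), ∃ x : E, ‖x‖ ≤ B ∧ ∀ f ∈ s, f x = Φ f :=
  ⟨‖Φ‖ + 1, by positivity, exists_forall_apply_eq_of_bidual Φ⟩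

/-- **James' sequences**: a nonreflexive space has arbitrarily small vectors `xₖ` and bounded
functionals `fₙ` with `fₙ xₖ = 1` for `n ≤ k` and `fₙ xₖ = 0` for `k < n`. -/
theorem exists_james_sequences {X : Type*} [NormedAddCommGroup X] [NormedSpace ℝ X]
    [CompleteSpace X] (hX : ¬ IsReflexiveSpace X) {δ : ℝ} (hδ : 0 < δ) :
    ∃ (C : ℝ) (x : ℕ → X) (f : ℕ → StrongDual ℝ X), 0 < C ∧ (∀ n, ‖x n‖ ≤ δ) ∧ (∀ n, ‖f n‖ ≤ C) ∧
      (∀ n k, n ≤ k → f n (x k) = 1) ∧ ∀ n k, k < n → f n (x k) = 0 := by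
  classical
  let J := NormedSpace.inclusionInDoubleDual ℝ X
  obtain ⟨Φ, hΦ⟩ : ∃ Φ, ∀ x, J x ≠ Φ := by
    simpa [IsReflexiveSpace, Function.Surjective] using hX
  obtain ⟨Ψ, hu, hΨJ⟩ := exists_annihilator_range_inclusion hΦ
  obtain ⟨B, hB, hΨ⟩ := exists_bound_forall_apply_eq_of_bidual Ψ
  -- Helly's lemma one dual higher: `Ψ` is represented on `Φ` and on the canonical images of the
  -- points of `A`.
  have hF : ∀ A : Finset X, ∃ f : StrongDual ℝ X,
      ‖f‖ ≤ B ∧ Φ f = 1 ∧ ∀ x ∈ A, f x = 0 := by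
    intro A
    obtain ⟨f, hf, h⟩ := hΨ (insert Φ (A.image J))
    refine ⟨f, hf, (h Φ (Finset.mem_insert_self _ _)).trans hu, fun x hx => ?_⟩
    have := h (J x) (Finset.mem_insert_of_mem (Finset.mem_image_of_mem J hx))
    rwa [hΨJ] at this
  choose F hFn hFΦ hFA using hF
  choose Y hYn hY using exists_forall_apply_eq_of_bidual Φ
  -- Alternating choice: each new functional kills all earlier vectors, and each new vector agrees
  -- with `Φ` on all functionals so far.
  obtain ⟨S, A, hS, hA⟩ : ∃ (S : ℕ → Finset (StrongDual ℝ X)) (A : ℕ → Finset X),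
      (∀ n, S (n + 1) = insert (F (A n)) (S n)) ∧ ∀ n, A (n + 1) = insert (Y (S (n + 1))) (A n) := by
    let st : ℕ → Finset (StrongDual ℝ X) × Finset X := fun n => Nat.rec (∅, ∅)
      (fun _ p => (insert (F p.2) p.1, insert (Y (insert (F p.2) p.1)) p.2)) n
    exact ⟨fun n => (st n).1, fun n => (st n).2, fun n => rfl, fun n => rfl⟩
  have hSm : Monotone S := monotone_nat_of_le_succ fun n => by rw [hS]; exact Finset.subset_insert _ _
  have hAm : Monotone A := monotone_nat_of_le_succ fun n => by rw [hA]; exact Finset.subset_insert _ _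
  let ε := δ / (‖Φ‖ + 1)
  have hε : 0 < ε := by positivity
  refine ⟨ε⁻¹ * B, fun n => ε • Y (S (n + 1)), fun n => ε⁻¹ • F (A n), by positivity,
    fun n => ?_, fun n => ?_, fun n k hnk => ?_, fun n k hkn => ?_⟩
  · rw [norm_smul, Real.norm_of_nonneg hε.le]
    calc ε * ‖Y (S (n + 1))‖ ≤ ε * (‖Φ‖ + 1) := by gcongr; exact hYn _
      _ = δ := div_mul_cancel₀ _ (by positivity)
  · rw [norm_smul, Real.norm_of_nonneg (inv_pos.2 hε).le]
    gcongr
    exact hFn _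
  · have hmem : F (A n) ∈ S (k + 1) := hSm (Nat.succ_le_succ hnk) (by rw [hS]; simp)
    simp [hY _ _ hmem, hFΦ, hε.ne']
  · have hmem : Y (S (k + 1)) ∈ A n := hAm (Nat.succ_le_of_lt hkn) (by rw [hA]; simp)
    simp [hFA _ _ hmem]

/-- The closed convex hull of a James sequence admits an affine self-map without fixed points
which is a small Lipschitz perturbation of the identity. -/
theorem exists_linear_perturbation_fixedPointFree {X : Type*} [NormedAddCommGroup X]
    [NormedSpace ℝ X] [CompleteSpace X] {C δ η : ℝ} (hδ : 0 < δ) (hη : 0 < η)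
    (hC : 0 < C) {x : ℕ → X} {f : ℕ → StrongDual ℝ X} (hx : ∀ n, ‖x n‖ ≤ δ) (hf : ∀ n, ‖f n‖ ≤ C)
    (h1 : ∀ n k, n ≤ k → f n (x k) = 1) (h0 : ∀ n k, k < n → f n (x k) = 0) :
    ∃ V : X →L[ℝ] X, ‖V‖ ≤ η ∧
      (∀ z ∈ closure (convexHull ℝ (Set.range x)),
        z + V z ∈ closure (convexHull ℝ (Set.range x)) ∧ V z ≠ 0) := by
  let u : ℕ → StrongDual ℝ X := fun n => f n - f (n + 1)
  -- The cap at 1 keeps `x k + c k • (x (k + 1) - x k)` on a segment; the other bound offsets `‖u n‖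
  -- ≤ 2 * C` and the step length `2 * δ`, so that the norms sum to at most `η`.
  let c : ℕ → ℝ := fun n => min 1 (η / (8 * C * δ)) * (1 / 2) ^ n
  have hc : ∀ n, 0 < c n := fun n => by positivity
  have hc1 : ∀ n, c n ≤ 1 := fun n =>
    mul_le_one₀ (min_le_left _ _) (by positivity) (pow_le_one₀ (by norm_num) (by norm_num))
  let v : ℕ → X →L[ℝ] X := fun n => c n • (u n).smulRight (x (n + 1) - x n)
  have hv : ∀ n, ‖v n‖ ≤ η / 2 * (1 / 2) ^ n := fun n => by
    have e1 : ‖u n‖ ≤ 2 * C := (norm_sub_le _ _).trans (by linarith [hf n, hf (n + 1)])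
    have e2 : ‖x (n + 1) - x n‖ ≤ 2 * δ := (norm_sub_le _ _).trans (by linarith [hx n, hx (n + 1)])
    simp only [v]
    rw [norm_smul, Real.norm_of_nonneg (hc n).le, ContinuousLinearMap.norm_smulRight_apply]
    calc c n * (‖u n‖ * ‖x (n + 1) - x n‖)
        ≤ (η / (8 * C * δ) * (1 / 2) ^ n) * ((2 * C) * (2 * δ)) := by
          gcongr
          exact mul_le_mul_of_nonneg_right (min_le_right _ _) (by positivity)
      _ = _ := by field_simp; ring
  have hgeo : HasSum (fun n : ℕ => η / 2 * (1 / 2 : ℝ) ^ n) (η / 2 * 2) :=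
    hasSum_geometric_two.mul_left _
  have hsum : Summable v := .of_norm_bounded hgeo.summable hv
  let V := ∑' n, v n
  have hV : ∀ z, HasSum (fun n => (c n * u n z) • (x (n + 1) - x n)) (V z) := fun z => by
    have := (ContinuousLinearMap.apply ℝ X z).hasSum hsum.hasSum
    simpa [v, mul_smul, Function.comp_def] using this
  refine ⟨V, (tsum_of_norm_bounded hgeo hv).trans (by linarith), fun z hz => ⟨?_, ?_⟩⟩
  · have hcl : IsClosed {z | z + V z ∈ closure (convexHull ℝ (Set.range x))} :=
      isClosed_closure.preimage (by fun_prop)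
    have hcv : Convex ℝ {z | z + V z ∈ closure (convexHull ℝ (Set.range x))} :=
      (convex_convexHull ℝ (Set.range x)).closure.linear_preimage
        ((ContinuousLinearMap.id ℝ X + V : X →L[ℝ] X) : X →ₗ[ℝ] X)
    refine closure_minimal (convexHull_min ?_ hcv) hcl hz
    rintro _ ⟨k, rfl⟩
    have hk : ∀ n, u n (x k) = if n = k then 1 else 0 := fun n => by
      simp only [u, sub_apply]
      split_ifs with hnk
      · subst hnk; rw [h1 _ _ le_rfl, h0 _ _ (Nat.lt_succ_self _), sub_zero]
      · rcases lt_or_gt_of_ne hnk with h | h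
        · rw [h1 _ _ h.le, h1 _ _ h, sub_self]
        · rw [h0 _ _ h, h0 _ _ (h.trans (Nat.lt_succ_self _)), sub_self]
    have hVk : V (x k) = c k • (x (k + 1) - x k) := by
      refine (hV (x k)).unique ?_
      convert hasSum_ite_eq k (c k • (x (k + 1) - x k)) using 2 with n
      rw [hk]
      split_ifs with hnk
      · rw [hnk, mul_one]
      · simp
    refine subset_closure ?_
    rw [hVk]
    exact (convex_convexHull ℝ (Set.range x)).add_smul_sub_mem
      (subset_convexHull ℝ _ (Set.mem_range_self k))
      (subset_convexHull ℝ _ (Set.mem_range_self (k + 1))) ⟨(hc k).le, hc1 k⟩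
  · intro hVz
    -- Applying `f (m + 1)` to `V z` isolates the term `c m * u m z`. Thus all `f n z` equal `f 0 z
    -- = 1`, whereas bounded functionals eventually vanishing at each point of the hull tend to 0 on
    -- its closure.
    have hu0 : ∀ m, f m z = f (m + 1) z := by
      intro m
      have e1 := (f (m + 1)).hasSum (hV z)
      have e2 : HasSum (fun n => f (m + 1) ((c n * u n z) • (x (n + 1) - x n))) (c m * u m z) := by
        convert hasSum_ite_eq m (c m * u m z) using 2 with n
        rw [map_smul, map_sub, smul_eq_mul]
        split_ifs with hnm
        · subst hnm; rw [h1 _ _ le_rfl, h0 _ _ (Nat.lt_succ_self _)]; ring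
        · rcases lt_or_gt_of_ne hnm with h | h
          · rw [h0 _ _ (by omega), h0 _ _ (by omega)]; ring
          · rw [h1 _ _ (by omega), h1 _ _ (by omega)]; ring
      have e3 := e1.unique e2
      rw [hVz, map_zero] at e3
      have e4 := (mul_eq_zero.1 e3.symm).resolve_left (hc m).ne'
      simpa [u, sub_eq_zero] using e4
    have hone : f 0 z = 1 := by
      have hcl : IsClosed {z | f 0 z = 1} := isClosed_eq (f 0).continuous continuous_const
      have hcv : Convex ℝ {z | f 0 z = 1} := by
        intro a ha b hb s t _ _ hst
        simp only [Set.mem_ofPred_eq] at ha hb ⊢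
        simp [ha, hb, hst]
      refine closure_minimal (convexHull_min ?_ hcv) hcl hz
      rintro _ ⟨k, rfl⟩
      exact h1 0 k k.zero_le
    have hall : ∀ n, f n z = 1 := fun n => by
      induction n with
      | zero => exact hone
      | succ n ih => rw [← hu0, ih]
    obtain ⟨w, hw, hzw⟩ := Metric.mem_closure_iff.1 hz (1 / C) (by positivity)
    obtain ⟨n, hn⟩ : ∃ N, ∀ n ≥ N, f n w = 0 := by
      have hcv : Convex ℝ {w | ∃ N, ∀ n ≥ N, f n w = 0} := by
        rintro a ⟨N, hN⟩ b ⟨M, hM⟩ s t _ _ _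
        refine ⟨max N M, fun n hn => ?_⟩
        simp [hN n (le_of_max_le_left hn), hM n (le_of_max_le_right hn)]
      refine convexHull_min ?_ hcv hw
      rintro _ ⟨k, rfl⟩
      exact ⟨k + 1, fun n hn => h0 n k hn⟩
    have e1 : f n (z - w) = 1 := by rw [map_sub, hall, hn n le_rfl, sub_zero]
    have e2 : |f n (z - w)| ≤ C * ‖z - w‖ :=
      ((f n).le_opNorm _).trans (mul_le_mul_of_nonneg_right (hf n) (norm_nonneg _))
    rw [e1, abs_one] at e2
    rw [dist_eq_norm, lt_div_iff₀ hC] at hzw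
    linarith

theorem exists_affine_fixedPointFree_of_not_reflexive {X : Type*} [NormedAddCommGroup X]
    [NormedSpace ℝ X] [CompleteSpace X] (hX : ¬ IsReflexiveSpace X) {L lam α : ℝ} (hL : 1 < L)
    (hlam : 0 < lam) (hα1 : α < 1) :
    ∃ K ∈ bccSubsets (Metric.closedBall (0 : X) 1), ∃ T : K → K,
      fixedPts T = ∅ ∧ IsAffineSelfMap T ∧
      ∀ x y : K,
        L⁻¹ * ‖(x : X) - (y : X)‖ ≤ ‖(T x : X) - (T y : X)‖ ∧
        ‖(T x : X) - (T y : X)‖ ≤ lam * ‖(x : X) - (y : X)‖ ^ α := by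
  obtain ⟨δ, hδ, hδ1, hδα⟩ := exists_scale_rpow_le two_pos hlam hα1
  obtain ⟨C, x, f, hC, hx, hf, h1, h0⟩ := exists_james_sequences hX hδ
  have hLi : L⁻¹ < 1 := inv_lt_one_of_one_lt₀ hL
  have hLp : 0 < L⁻¹ := by positivity
  -- The norm bound `1 - L⁻¹` is exactly what the lower estimate by `L⁻¹` can lose.
  obtain ⟨V, hVn, hV⟩ := exists_linear_perturbation_fixedPointFree hδ (sub_pos.2 hLi)
    hC hx hf h1 h0
  let K := closure (convexHull ℝ (Set.range x))
  have hKδ : K ⊆ Metric.closedBall 0 δ := by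
    refine closure_minimal (convexHull_min ?_ (convex_closedBall _ _)) Metric.isClosed_closedBall
    rintro _ ⟨k, rfl⟩
    simpa using hx k
  have hVle : ∀ z, ‖V z‖ ≤ (1 - L⁻¹) * ‖z‖ := fun z =>
    (V.le_opNorm z).trans (mul_le_mul_of_nonneg_right hVn (norm_nonneg _))
  refine ⟨K, ⟨hKδ.trans (Metric.closedBall_subset_closedBall hδ1),
    ⟨x 0, subset_closure (subset_convexHull ℝ _ ⟨0, rfl⟩)⟩,
    Metric.isBounded_closedBall.subset hKδ, isClosed_closure, (convex_convexHull ℝ _).closure⟩,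
    fun z => ⟨z + V z, (hV z z.2).1⟩, ?_, ?_, fun y z => ?_⟩
  · rw [Set.eq_empty_iff_forall_notMem]
    intro z hz
    have hz' : (z : X) = z + V z := congrArg Subtype.val hz
    exact (hV z z.2).2 (by simpa using hz')
  · intro y z w a b _ _ _ hw
    simp only [hw, map_add, map_smul]
    module
  · have e : ((y : X) + V y) - (z + V z) = (y - z) + V (y - z) := by rw [map_sub]; abel
    have hd : ‖(y : X) - z‖ ≤ 2 * δ := by
      have h2 : ‖(y : X)‖ ≤ δ := by simpa using hKδ y.2
      have h3 : ‖(z : X)‖ ≤ δ := by simpa using hKδ z.2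
      exact (norm_sub_le _ _).trans (by linarith)
    have hVd := hVle (y - z)
    have hdn := norm_nonneg ((y : X) - z)
    simp only [e]
    constructor
    · have := norm_sub_norm_le ((y : X) - z) (-V (y - z))
      rw [norm_neg, sub_neg_eq_add] at this
      linarith
    · calc ‖((y : X) - z) + V (y - z)‖ ≤ 2 * ‖(y : X) - z‖ := by
            refine (norm_add_le _ _).trans ?_
            nlinarith
        _ ≤ 2 * ((2 * δ) ^ (1 - α) * ‖(y : X) - z‖ ^ α) := by
            gcongr
            exact le_rpow_mul_rpow hdn hd hα1
        _ = (2 * (2 * δ) ^ (1 - α)) * ‖(y : X) - z‖ ^ α := by ring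
        _ ≤ _ := by gcongr

end Nonreflexive

/-! ### Compact sets, small balls and the shift. -/

section Conclusion

variable {X : Type*} [NormedAddCommGroup X] [NormedSpace ℝ X]

/-- Compact convex sets have the fixed point property for nonexpansive maps. -/
theorem hasFPP_of_isCompact [CompleteSpace X] {K : Set X} (hne : K.Nonempty) (hcv : Convex ℝ K)
    (hK : IsCompact K) : HasFPP K := by
  intro T hT
  obtain ⟨x₀, hx₀⟩ := hne
  have : CompactSpace K := isCompact_iff_compactSpace.1 hK
  have : Nonempty K := ⟨⟨x₀, hx₀⟩⟩
  obtain ⟨p, -, hp⟩ := isCompact_univ.exists_isMinOn (Set.univ_nonempty (α := K))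
    (continuous_id.dist hT.continuous).continuousOn
  have hmin : ∀ y : K, dist p (T p) ≤ dist y (T y) := fun y => hp (Set.mem_univ y)
  obtain ⟨D, hD⟩ := Metric.isBounded_iff.1 hK.isBounded
  have hD0 : 0 ≤ D := dist_nonneg.trans (hD hx₀ hx₀)
  -- Contracting `T` towards `x₀` by a factor `1 - s` yields a Banach fixed point, which `T` moves
  -- by at most `s * D`; letting `s` tend to 0 kills the minimal displacement.
  have happrox : ∀ s : ℝ, 0 < s → s ≤ 1 → dist p (T p) ≤ s * D := by
    intro s hs hs1
    let U : K → K := fun x => ⟨(T x : X) + s • (x₀ - (T x : X)),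
      hcv.add_smul_sub_mem (T x).2 hx₀ ⟨hs.le, hs1⟩⟩
    have hU : ContractingWith (1 - s).toNNReal U := by
      refine ⟨by rw [← NNReal.coe_lt_coe, Real.coe_toNNReal _ (by linarith)]; simpa using hs,
        LipschitzWith.of_dist_le_mul fun x y => ?_⟩
      rw [Real.coe_toNNReal _ (by linarith), Subtype.dist_eq, dist_eq_norm]
      have e : (U x : X) - U y = (1 - s) • ((T x : X) - T y) := by simp only [U]; module
      rw [e, norm_smul, Real.norm_of_nonneg (by linarith), ← dist_eq_norm, ← Subtype.dist_eq]
      exact mul_le_mul_of_nonneg_left (by simpa using hT.dist_le_mul x y) (by linarith)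
    let z := ContractingWith.fixedPoint U hU
    have hz : U z = z := hU.fixedPoint_isFixedPt
    refine (hmin z).trans ?_
    have hz' : (z : X) = (T z : X) + s • (x₀ - (T z : X)) := (congrArg Subtype.val hz).symm
    have e : (z : X) - T z = s • (x₀ - (T z : X)) := sub_eq_iff_eq_add'.2 hz'
    rw [Subtype.dist_eq, dist_eq_norm, e, norm_smul, Real.norm_of_nonneg hs.le, ← dist_eq_norm]
    exact mul_le_mul_of_nonneg_left (hD hx₀ (T z).2) hs.le
  refine ⟨p, dist_le_zero.1 (le_of_forall_pos_le_add fun ε hε => ?_)⟩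
  have hs : 0 < min 1 (ε / (D + 1)) := by positivity
  refine (happrox _ hs (min_le_left _ _)).trans ?_
  calc min 1 (ε / (D + 1)) * D ≤ ε / (D + 1) * (D + 1) := by
        gcongr
        · exact min_le_right _ _
        · linarith
    _ = 0 + ε := by field_simp; ring

theorem isCompact_of_hasHFPP [CompleteSpace X] {K : Set X} (hb : Bornology.IsBounded K)
    (hcl : IsClosed K) (hcv : Convex ℝ K) {α : ℝ} (h0 : 0 < α) (h1 : α < 1) (h : HasHFPP α K) :
    IsCompact K := by
  by_contra hnc
  obtain ⟨T, hT, hfix⟩ := exists_holder_fixedPointFree hb hcl hcv hnc h0 h1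
  exact (h T hT).ne_empty hfix

theorem linearIndependent_of_isBasicSeq {x : ℕ → X} (hx : IsBasicSeq x) :
    LinearIndependent ℝ x := by
  obtain ⟨b, hb⟩ := hx
  have := b.linearIndependent.map' (Submodule.subtype _) (Submodule.ker_subtype _)
  have e : (Submodule.span ℝ (Set.range x)).topologicalClosure.subtype ∘ b = x := funext hb
  rwa [e] at this

theorem not_isCompact_closedBall_of_linearIndependent {x : ℕ → X} (hx : LinearIndependent ℝ x)
    {r : ℝ} (hr : 0 < r) : ¬ IsCompact (Metric.closedBall (0 : X) r) := by
  intro hK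
  have := FiniteDimensional.of_isCompact_closedBall₀ ℝ hr hK
  exact Infinite.not_finite (α := ℕ) hx.finite

/-- A ball of radius at most `ε` is noncompact in infinite dimension, and a self-map displaces its
centre by at most the radius. -/
theorem exists_holder_fixedPointFree_minDisplacement_le [CompleteSpace X] {x : ℕ → X}
    (hx : LinearIndependent ℝ x) {α : ℝ} (h0 : 0 < α) (h1 : α < 1) {ε : ℝ} (hε : 0 < ε) :
    ∃ K ∈ bccSubsets (Metric.closedBall (0 : X) 1), ∃ T : K → K,
      IsHolderNonexpansive α T ∧ fixedPts T = ∅ ∧ minDisplacement T ≤ ε := by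
  have hr : 0 < min 1 ε := by positivity
  let K := Metric.closedBall (0 : X) (min 1 ε)
  obtain ⟨T, hT, hfix⟩ := exists_holder_fixedPointFree (K := K) Metric.isBounded_closedBall
    Metric.isClosed_closedBall (convex_closedBall _ _)
    (not_isCompact_closedBall_of_linearIndependent hx hr) h0 h1
  refine ⟨K, ⟨Metric.closedBall_subset_closedBall (min_le_left _ _),
    Metric.nonempty_closedBall.2 hr.le, Metric.isBounded_closedBall, Metric.isClosed_closedBall,
    convex_closedBall _ _⟩, T, hT, hfix, ?_⟩
  let o : K := ⟨0, Metric.mem_closedBall_self hr.le⟩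
  refine (ciInf_le ⟨0, ?_⟩ o).trans ?_
  · rintro _ ⟨z, rfl⟩; exact norm_nonneg _
  · have : ‖(T o : X)‖ ≤ min 1 ε := mem_closedBall_zero_iff.1 (T o).2
    simpa [o] using this.trans (min_le_right _ _)

/-- If the unit ball has the fixed point property, the shift on the convex hull of a normalized
sequence `1`-dominating its shift has no nonexpansive extension to the unit ball. -/
theorem one_notMem_extensionExponents {e : ℕ → X} (hn : IsNormalizedSeq e)
    (hli : LinearIndependent ℝ e) (hdom : OneDominates e fun i => e (i + 1))
    (hFPP : HasFPP (Metric.closedBall (0 : X) 1)) :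
    (1 : ℝ) ∉ extensionExponents (Metric.closedBall (0 : X) 1) := by
  rintro ⟨-, hext⟩
  let φ := Finsupp.linearCombination ℝ e
  have hφ : Function.Injective φ := hli
  let sh : (ℕ →₀ ℝ) → (ℕ →₀ ℝ) := Finsupp.mapDomain Nat.succ
  have hφsh : ∀ a, φ (sh a) = a.sum fun i c => c • e (i + 1) := fun a => by
    simp only [φ, sh, Finsupp.linearCombination_mapDomain]
    rw [Finsupp.linearCombination_apply]; rfl
  let Δ : Set (ℕ →₀ ℝ) := {a | (∀ i, 0 ≤ a i) ∧ (a.sum fun _ c => c) = 1}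
  have hsum_add : ∀ a b : ℕ →₀ ℝ, ((a + b).sum fun _ c => c)
      = (a.sum fun _ c => c) + b.sum fun _ c => c := fun a b =>
    Finsupp.sum_add_index' (fun _ => rfl) fun _ _ _ => rfl
  have hsum_smul : ∀ (t : ℝ) (a : ℕ →₀ ℝ), ((t • a).sum fun _ c => c)
      = t * a.sum fun _ c => c := fun t a => by
    rw [Finsupp.sum_smul_index' (fun _ => rfl), Finsupp.mul_sum]; rfl
  have hΔcv : Convex ℝ Δ := by
    rintro a ⟨ha, ha'⟩ b ⟨hb, hb'⟩ s t hs ht hst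
    refine ⟨fun i => ?_, ?_⟩
    · simpa using add_nonneg (mul_nonneg hs (ha i)) (mul_nonneg ht (hb i))
    · rw [hsum_add, hsum_smul, hsum_smul, ha', hb', mul_one, mul_one, hst]
  have hΔsh : ∀ a ∈ Δ, sh a ∈ Δ := by
    rintro a ⟨ha, ha'⟩
    refine ⟨fun i => ?_, ?_⟩
    · rcases i with _ | i
      · simp only [sh]
        rw [Finsupp.mapDomain_of_notMem_range _ _ (by simp)]
      · simp only [sh]
        rw [← Nat.succ_eq_add_one, Finsupp.mapDomain_apply Nat.succ_injective]
        exact ha i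
    · simp only [sh]
      rw [Finsupp.sum_mapDomain_index (fun _ => rfl) fun _ _ _ => rfl, ha']
  -- Only finite convex combinations are taken: finite support is what excludes fixed points of the
  -- shift, and the closure is not needed.
  let K : Set X := φ '' Δ
  have hKB : K ⊆ Metric.closedBall (0 : X) 1 := by
    rintro _ ⟨a, ⟨ha, ha'⟩, rfl⟩
    rw [mem_closedBall_zero_iff, ← ha']
    simp only [φ, Finsupp.linearCombination_apply, Finsupp.sum]
    refine (norm_sum_le _ _).trans (Finset.sum_le_sum fun i _ => ?_)
    rw [norm_smul, hn i, mul_one, Real.norm_of_nonneg (ha i)]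
  have hKne : K.Nonempty := by
    refine ⟨_, Finsupp.single 0 1, ⟨fun i => ?_, by simp⟩, rfl⟩
    rw [Finsupp.single_apply]; split_ifs <;> norm_num
  choose c hcΔ hcφ using fun x : K => x.2
  let F : K → K := fun x => ⟨φ (sh (c x)), sh (c x), hΔsh _ (hcΔ x), rfl⟩
  have hF : IsHolderNonexpansive 1 F := by
    intro x y
    have e1 : (F x : X) - F y = φ (sh (c x - c y)) := by
      simp only [F, sh, ← map_sub]
      congr 1
      rw [← Finsupp.mapDomain.addMonoidHom_apply, ← Finsupp.mapDomain.addMonoidHom_apply, ← map_sub]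
      rfl
    have e2 : (x : X) - y = φ (c x - c y) := by rw [map_sub, hcφ, hcφ]
    rw [Real.rpow_one, Subtype.dist_eq, Subtype.dist_eq, dist_eq_norm, dist_eq_norm, e1, e2, hφsh]
    exact hdom (c x - c y)
  obtain ⟨T, hT, hTF⟩ := hext K hKB hKne (Metric.isBounded_closedBall.subset hKB)
    (hΔcv.linear_image φ) F hF
  obtain ⟨p, hp⟩ := hFPP (fun x => ⟨T x, hKB (T x).2⟩) (LipschitzWith.of_dist_le_mul fun x y => by
    simpa [Subtype.dist_eq] using hT x y)
  have hp' : (p : X) = T p := congrArg Subtype.val hp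
  have hpK : (p : X) ∈ K := hp' ▸ (T p).2
  have hfix : φ (c ⟨p, hpK⟩) = φ (sh (c ⟨p, hpK⟩)) := by
    have h1 := congrArg Subtype.val (hTF ⟨p, hpK⟩)
    rw [hcφ]
    exact hp'.trans h1
  have hsh := hφ hfix
  -- A shift-invariant coefficient vector has zeroth entry 0 and each entry equal to its
  -- predecessor, which contradicts total mass 1.
  have hzero : c ⟨p, hpK⟩ = 0 := by
    ext i
    induction i with
    | zero =>
      rw [hsh]
      simp only [sh]
      rw [Finsupp.mapDomain_of_notMem_range _ _ (by simp)]; rfl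
    | succ i ih =>
      rw [hsh]
      simp only [sh]
      rw [← Nat.succ_eq_add_one, Finsupp.mapDomain_apply Nat.succ_injective, ih]; rfl
  have := (hcΔ ⟨p, hpK⟩).2
  rw [hzero] at this
  simp at this

end Conclusion

theorem theorem3p6 (X : Type*) [NormedAddCommGroup X] [NormedSpace ℝ X] [CompleteSpace X] :
    (∀ K ∈ bccSubsets (Set.univ : Set X),
      (∃ α : ℝ, 0 < α ∧ α < 1 ∧ HasHFPP α K) → HasFPP K) ∧
    (¬ IsReflexiveSpace X →
      ∀ L lam α : ℝ, 1 < L → 1 / L < lam → lam ≤ 1 → 0 < α → α < 1 →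
        ∃ K ∈ bccSubsets (Metric.closedBall (0 : X) 1), ∃ T : K → K,
          fixedPts T = ∅ ∧ IsAffineSelfMap T ∧
          ∀ x y : K,
            L⁻¹ * ‖(x : X) - (y : X)‖ ≤ ‖(T x : X) - (T y : X)‖ ∧
            ‖(T x : X) - (T y : X)‖ ≤ lam * ‖(x : X) - (y : X)‖ ^ α) ∧
    ((∃ x : ℕ → X, IsBasicSeq x ∧ IsNormalizedSeq x ∧
        ∃ n : ℕ → ℕ, StrictMono n ∧ OneDominates x (fun i => x (n i))) →
      ∀ α : ℝ, 0 < α → α < 1 →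
        ∃ K ∈ bccSubsets (Metric.closedBall (0 : X) 1), ∃ T : K → K,
          IsHolderNonexpansive α T ∧ fixedPts T = ∅ ∧
          minDisplacement T ≤ (1 / 2 : ℝ) ^ ((2 - α) / (1 - α))) ∧
    ((∃ e : ℕ → X, IsNormalizedSeq e ∧ IsOneSubspreading e) → SpaceHasFPP X →
      (1 : ℝ) ∉ extensionExponents (Metric.closedBall (0 : X) 1)) := by
  refine ⟨?_, ?_, ?_, ?_⟩
  · rintro K ⟨-, hne, hb, hcl, hcv⟩ ⟨α, h0, h1, h⟩
    exact hasFPP_of_isCompact hne hcv (isCompact_of_hasHFPP hb hcl hcv h0 h1 h)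
  · intro hX L lam α hL hlam _ _ hα1
    exact exists_affine_fixedPointFree_of_not_reflexive hX hL
      ((one_div_pos.2 (one_pos.trans hL)).trans hlam) hα1
  · rintro ⟨x, hx, -, -⟩ α h0 h1
    exact exists_holder_fixedPointFree_minDisplacement_le (linearIndependent_of_isBasicSeq hx)
      h0 h1 (by positivity)
  · rintro ⟨e, hn, he, hdom⟩ hX
    exact one_notMem_extensionExponents hn (linearIndependent_of_isBasicSeq he)
      (hdom (fun i => i + 1) fun i j h => Nat.succ_lt_succ h)
      (hX _ ⟨Set.subset_univ _, Metric.nonempty_closedBall.2 zero_le_one,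
        Metric.isBounded_closedBall, Metric.isClosed_closedBall, convex_closedBall _ _⟩)
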